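/- For a topological space $X$ and $N\ge 0$ let $F_N(X)=\{(p_1,\dots,p_N)\in X^N : p_i\ne p_j \text{ for } i\ne j\}$, with the subspace topology of the product, on which the symmetric group $S_N$ acts by permuting coordinates. Put $UF_n(X)=F_n(X)/S_n$ and $UF_{n,m}(X)=F_{n+m}(X)/(S_n\times S_m)$ with the quotient topologies, where $S_n\times S_m\le S_{n+m}$ permutes the first $n$ and the last $m$ coordinates separately, and let $q:UF_{n,m}(X)\to UF_n(X)$ be the map that forgets the last $m$ coordinates. Theorem D. Let $n\ge 3$. The fibration $q:UF_{n,m}(\mathbb{R}P^2)\to UF_n(\mathbb{R}P^2)$ admits a cross-section, that is, a continuous map $s:UF_n(\mathbb{R}P^2)\to UF_{n,m}(\mathbb{R}P^2)$ with $q\circ s=\mathrm{id}$, for $m=kn(2n-1)(2n-2)$ for every integer $k\ge 1$, and for $m=2n(n-1)$. -/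

import Mathlib

namespace MixedConf

/-- The unit sphere in Euclidean 3-space. -/
abbrev Sphere2 : Type := Metric.sphere (0 : EuclideanSpace ℝ (Fin 3)) 1

/-- The antipodal relation on the 2-sphere: `x` is related to `y` when `x = y` or `x = -y`. -/
def antipodal : Setoid Sphere2 where
  r x y := x = y ∨ x = -y
  iseqv :=
    { refl := fun _ => Or.inl rfl
      symm := by
        rintro x y (h | h)
        · exact Or.inl h.symm
        · exact Or.inr (by rw [h, neg_neg])
      trans := by
        rintro x y z (rfl | rfl) (rfl | rfl)
        · exact Or.inl rfl
        · exact Or.inr rfl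
        · exact Or.inr rfl
        · exact Or.inl (by rw [neg_neg]) }

/-- The real projective plane, the quotient space of the 2-sphere by the antipodal map
(with the quotient topology). -/
abbrev RP2 : Type := Quotient antipodal

/-- The ordered configuration space of `N` pairwise distinct points of `X`, a subspace of the
product `X ^ N`. -/
abbrev OrdConf (N : ℕ) (X : Type*) : Type _ := {p : Fin N → X // Function.Injective p}

/-- The symmetric group acts on ordered configurations by permuting the coordinates. -/
instance permAction (N : ℕ) (X : Type*) : MulAction (Equiv.Perm (Fin N)) (OrdConf N X) where
  smul σ p := ⟨fun i => p.1 (σ⁻¹ i), p.2.comp (σ⁻¹).injective⟩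
  one_smul _ := rfl
  mul_smul σ τ p := by
    apply Subtype.ext
    funext i
    change p.1 ((σ * τ)⁻¹ i) = p.1 (τ⁻¹ (σ⁻¹ i))
    rw [mul_inv_rev, Equiv.Perm.mul_apply]

/-- The unordered configuration space `F_N(X) / S_N`, with the quotient topology. -/
abbrev UConf (N : ℕ) (X : Type*) : Type _ :=
  Quotient (MulAction.orbitRel (Equiv.Perm (Fin N)) (OrdConf N X))

/-- The subgroup `S_n × S_m` of `S_(n+m)`: the first factor permutes the first `n` indices, the
second factor permutes the last `m` indices. -/
def blockSubgroup (n m : ℕ) : Subgroup (Equiv.Perm (Fin (n + m))) :=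
  ((finSumFinEquiv (m := n) (n := m)).permCongrHom.toMonoidHom.comp
    (Equiv.Perm.sumCongrHom (Fin n) (Fin m))).range

/-- The mixed configuration space `F_(n+m)(X) / (S_n × S_m)`, with the quotient topology. -/
abbrev MConf (n m : ℕ) (X : Type*) : Type _ :=
  Quotient (MulAction.orbitRel (blockSubgroup n m) (OrdConf (n + m) X))

/-- Forget the last `m` points of an ordered configuration of `n + m` points. -/
def forgetOrd (n m : ℕ) (X : Type*) (p : OrdConf (n + m) X) : OrdConf n X :=
  ⟨fun i => p.1 (Fin.castAdd m i), p.2.comp (Fin.castAdd_injective n m)⟩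

theorem forgetOrd_rel (n m : ℕ) (X : Type*) (p p' : OrdConf (n + m) X)
    (h : (MulAction.orbitRel (blockSubgroup n m) (OrdConf (n + m) X)).r p p') :
    (MulAction.orbitRel (Equiv.Perm (Fin n)) (OrdConf n X)).r
      (forgetOrd n m X p) (forgetOrd n m X p') := by
  obtain ⟨⟨g, hg⟩, rfl⟩ := h
  obtain ⟨⟨σ, τ⟩, hστ⟩ := hg
  refine ⟨σ, ?_⟩
  apply Subtype.ext
  funext i
  have key : Fin.castAdd m (σ⁻¹ i) = g⁻¹ (Fin.castAdd m i) := by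
    rw [Equiv.Perm.eq_inv_iff_eq, ← hστ]
    simp [Equiv.permCongrHom, Equiv.permCongr_apply]
  exact congrArg p'.1 key

/-- The map `q : F_(n+m)(X) / (S_n × S_m) → F_n(X) / S_n` that forgets the last `m` points. -/
def forget (n m : ℕ) (X : Type*) [TopologicalSpace X] : C(MConf n m X, UConf n X) where
  toFun := Quotient.map (forgetOrd n m X) (forgetOrd_rel n m X)
  continuous_toFun := by
    refine Continuous.quotient_map' (f := forgetOrd n m X) ?_ (forgetOrd_rel n m X)
    refine Continuous.subtype_mk (continuous_pi fun i => ?_) _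
    exact (continuous_apply (A := fun _ : Fin (n + m) => X) (Fin.castAdd m i)).comp
      continuous_subtype_val

/-- A continuous map `f` admits a cross-section if it has a continuous right inverse defined on
the whole base. -/
def HasCrossSection {E B : Type*} [TopologicalSpace E] [TopologicalSpace B] (f : C(E, B)) : Prop :=
  ∃ s : C(B, E), f.comp s = ContinuousMap.id B

end MixedConf

/-! Lift the points of the projective plane to unit vectors `x i`. For `i ≠ j`, stereographic
projection from `-x i` sends `x j` and `-x j` to two nonzero vectors of the plane tangent at `x i`.
Shrunk and added to `x i`, they give new points near the line of `x i`; rescaling by `r` nearly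
equal factors gives `2 r n (n - 1)` new points in all.

They are distinct. Around one old point, stereographic projection is injective and quantitatively so
(`smul_stereo_ne`); direction alone would not do, since collinear points share it. Around different
old points, the displacements are small compared with the angles (`add_ne_smul_add`).

Both signs of `x j` are used, so renumbering the points or changing the signs of their lifts only
permutes the new points, up to sign (`satellite_eq_of_symm`). The construction therefore descends to
unordered configurations. The values of `m` are `r = k (2n - 1)` and `r = 1`. -/

open scoped RealInnerProductSpace

namespace MixedConf

/-! ### Stereographic projection and separation estimates -/

section Stereo

variable {E : Type*} [NormedAddCommGroup E] [InnerProductSpace ℝ E]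

/-- The stereographic projection, from the antipode of the unit vector `a`, to the orthogonal
complement of `a`. -/
noncomputable def stereo (a v : E) : E := (1 + ⟪a, v⟫)⁻¹ • (v - ⟪a, v⟫ • a)

theorem stereo_smul_smul {c : ℝ} (hc : c * c = 1) (a v : E) :
    stereo (c • a) (c • v) = c • stereo a v := by
  have h : ⟪c • a, c • v⟫ = ⟪a, v⟫ := by
    rw [real_inner_smul_left, real_inner_smul_right, ← mul_assoc, hc, one_mul]
  simp only [stereo, h]
  module

theorem inner_stereo {a : E} (ha : ‖a‖ = 1) (v : E) : ⟪a, stereo a v⟫ = 0 := by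
  simp [stereo, inner_smul_right, inner_sub_right, ha]

theorem norm_stereo_sq {a v : E} (ha : ‖a‖ = 1) (hv : ‖v‖ = 1) (h : 1 + ⟪a, v⟫ ≠ 0) :
    ‖stereo a v‖ ^ 2 = (1 - ⟪a, v⟫) / (1 + ⟪a, v⟫) := by
  rw [stereo, norm_smul, mul_pow, norm_sub_sq_real, norm_smul, inner_smul_right, hv, ha,
    real_inner_comm a v]
  simp only [Real.norm_eq_abs, mul_one, sq_abs]
  field_simp
  ring

/-- The numerator is the squared chordal distance of `v` and `v'`, so this is injectivity of the
projection in quantitative form. -/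
theorem norm_stereo_sub_sq {a v v' : E} (ha : ‖a‖ = 1) (hv : ‖v‖ = 1) (hv' : ‖v'‖ = 1)
    (h : 1 + ⟪a, v⟫ ≠ 0) (h' : 1 + ⟪a, v'⟫ ≠ 0) :
    ‖stereo a v - stereo a v'‖ ^ 2 =
      2 * (1 - ⟪v, v'⟫) / ((1 + ⟪a, v⟫) * (1 + ⟪a, v'⟫)) := by
  have haa : ⟪a, a⟫ = 1 := by rw [real_inner_self_eq_norm_sq, ha, one_pow]
  rw [norm_sub_sq_real, norm_stereo_sq ha hv h, norm_stereo_sq ha hv' h']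
  simp only [stereo, inner_smul_left, inner_smul_right, inner_sub_left, inner_sub_right, haa,
    real_inner_comm a v, RCLike.conj_to_real]
  field_simp
  ring

theorem abs_inner_lt_one_iff {a v : E} : |⟪a, v⟫| < 1 ↔ 0 < 1 - ⟪a, v⟫ ^ 2 := by
  rw [sub_pos, sq_lt_one_iff_abs_lt_one]

/-- Scaled stereographic images of distinct, well separated points are distinct when the scales
are close to each other. -/
theorem smul_stereo_ne {a v v' : E} (ha : ‖a‖ = 1) (hv : ‖v‖ = 1) (hv' : ‖v'‖ = 1)
    (h : |⟪a, v⟫| < 1) (h' : |⟪a, v'⟫| < 1) {D c c' : ℝ} (hD : 0 < D) (hD1 : D ≤ 1)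
    (hvv : D ≤ 2 * (1 - ⟪v, v'⟫)) (hc : 1 ≤ c) (hcc : |c' - c| < D / 2) :
    c • stereo a v ≠ c' • stereo a v' := by
  intro heq
  obtain ⟨h1, h2⟩ := abs_lt.1 h
  obtain ⟨h3, h4⟩ := abs_lt.1 h'
  have e : c • (stereo a v - stereo a v') = (c' - c) • stereo a v' := by
    rw [smul_sub, heq]; module
  have e2 : c ^ 2 * ‖stereo a v - stereo a v'‖ ^ 2 = (c' - c) ^ 2 * ‖stereo a v'‖ ^ 2 := by
    have := congrArg (fun y => ‖y‖ ^ 2) e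
    simpa [norm_smul, mul_pow] using this
  rw [norm_stereo_sub_sq ha hv hv' (by linarith) (by linarith),
    norm_stereo_sq ha hv' (by linarith)] at e2
  have p1 : 0 < 1 + ⟪a, v⟫ := by linarith
  have p2 : 0 < 1 + ⟪a, v'⟫ := by linarith
  -- Without denominators, the left side is at least `D`, while the right side is less than `(D / 2)
  -- ^ 2 * 4 ≤ D`.
  field_simp at e2
  have hs : (c' - c) ^ 2 < (D / 2) ^ 2 := sq_lt_sq' (abs_lt.1 hcc).1 (abs_lt.1 hcc).2
  have q1 : D ≤ c ^ 2 * (2 * (1 - ⟪v, v'⟫)) :=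
    hvv.trans (le_mul_of_one_le_left (hD.le.trans hvv) (one_le_pow₀ hc))
  have q2 : (1 + ⟪a, v⟫) * (1 - ⟪a, v'⟫) ≤ 4 := by nlinarith
  have q3 : 0 < (1 + ⟪a, v⟫) * (1 - ⟪a, v'⟫) := mul_pos p1 (by linarith)
  have q4 : (c' - c) ^ 2 * ((1 + ⟪a, v⟫) * (1 - ⟪a, v'⟫)) < D := by nlinarith
  nlinarith

/-- Small perturbations of independent unit vectors are not proportional. -/
theorem add_ne_smul_add_of_abs_le {a b e f : E} (ha : ‖a‖ = 1) (hb : ‖b‖ = 1) {D : ℝ} (hD : 0 < D)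
    (hD1 : D ≤ 1) (hab : D ≤ 1 - ⟪a, b⟫ ^ 2) (he : ‖e‖ ≤ D / 4) (hf : ‖f‖ ≤ D / 4) {c : ℝ}
    (hc : |c| ≤ 1) : a + e ≠ c • (b + f) := by
  intro h
  have h1 : a - c • b = c • f - e := by
    rw [sub_eq_sub_iff_add_eq_add, h]; module
  have h2 : ‖a - c • b‖ ≤ D / 2 := by
    rw [h1]
    refine (norm_sub_le _ _).trans ?_
    rw [norm_smul, Real.norm_eq_abs]
    nlinarith [abs_nonneg c, norm_nonneg f]
  have h3 : ‖a - c • b‖ ^ 2 = 1 - 2 * (c * ⟪a, b⟫) + c ^ 2 := by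
    rw [norm_sub_sq_real, ha, norm_smul, hb, inner_smul_right, Real.norm_eq_abs, mul_one, sq_abs,
      one_pow]
  have h4 := pow_le_pow_left₀ (norm_nonneg _) h2 2
  -- The squared norm is `(1 - ⟪a, b⟫ ^ 2) + (c - ⟪a, b⟫) ^ 2 ≥ D`, which exceeds `(D / 2) ^ 2` as
  -- `0 < D ≤ 1`.
  nlinarith [sq_nonneg (c - ⟪a, b⟫)]

/-- The roles of `a` and `b` are symmetric: when `|c| ≥ 1`, exchange them and use `c⁻¹`. -/
theorem add_ne_smul_add {a b e f : E} (ha : ‖a‖ = 1) (hb : ‖b‖ = 1) {D : ℝ} (hD : 0 < D)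
    (hD1 : D ≤ 1) (hab : D ≤ 1 - ⟪a, b⟫ ^ 2) (he : ‖e‖ ≤ D / 4) (hf : ‖f‖ ≤ D / 4) {c : ℝ}
    (hc : c ≠ 0) : a + e ≠ c • (b + f) := by
  rcases le_total |c| 1 with h | h
  · exact add_ne_smul_add_of_abs_le ha hb hD hD1 hab he hf h
  · intro heq
    refine add_ne_smul_add_of_abs_le hb ha hD hD1 (by rwa [real_inner_comm]) hf he (c := c⁻¹)
      (by rw [abs_inv]; exact inv_le_one_of_one_le₀ h) ?_
    rw [heq, inv_smul_smul₀ hc]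

end Stereo

/-! ### Construction of the new points -/

section Satellites

variable {E : Type*} [NormedAddCommGroup E] [InnerProductSpace ℝ E] {ι : Type*}

/-- A sign, regarded as a real number. -/
def realSign (s : ℤˣ) : ℝ := ((s : ℤ) : ℝ)

theorem realSign_mul (s t : ℤˣ) : realSign (s * t) = realSign s * realSign t := by
  simp [realSign]

theorem realSign_mul_self (s : ℤˣ) : realSign s * realSign s = 1 := by
  rw [← realSign_mul, ← sq, Int.units_sq, realSign, Units.val_one, Int.cast_one]

theorem abs_realSign (s : ℤˣ) : |realSign s| = 1 := by
  rcases Int.units_eq_one_or s with rfl | rfl <;> simp [realSign]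

/-- Pairing with `a` forces `c = 1`: the affine tangent plane at `a` is a chart of the projective
plane. -/
theorem eq_of_add_eq_smul_add {a e f : E} (ha : ‖a‖ = 1) (he : ⟪a, e⟫ = 0) (hf : ⟪a, f⟫ = 0)
    {c : ℝ} (h : a + e = c • (a + f)) : e = f := by
  have h1 := congrArg (fun v => ⟪a, v⟫) h
  simp only [inner_add_right, inner_smul_right, he, hf, real_inner_self_eq_norm_sq, ha] at h1
  obtain rfl : c = 1 := by linarith
  rw [one_smul] at h
  exact add_left_cancel h

/-- Families of unit vectors that span pairwise distinct lines. -/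
structure SpansDistinctLines (x : ι → E) : Prop where
  norm_eq_one : ∀ i, ‖x i‖ = 1
  abs_inner_lt_one : Pairwise fun i j => |⟪x i, x j⟫| < 1

/-- The ordered pairs of distinct elements. -/
abbrev DistinctPair (ι : Type*) : Type _ := {p : ι × ι // p.1 ≠ p.2}

/-- The permutation of the ordered pairs of distinct elements induced by a permutation. -/
def distinctPairPerm (σ : Equiv.Perm ι) : Equiv.Perm (DistinctPair ι) :=
  (Equiv.prodCongr σ σ).subtypeEquiv fun p => (σ.injective.ne_iff (x := p.1) (y := p.2)).symm

/-- The indices of the `2 r` new points attached to every ordered pair of distinct points. -/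
abbrev SatelliteIndex (ι : Type*) (r : ℕ) : Type _ := (DistinctPair ι × ℤˣ) × Fin r

/-- The permutation of the indices of the new points induced by a permutation of the old points
and a change of the signs of their lifts. -/
def satellitePerm (r : ℕ) (σ : Equiv.Perm ι) (ε : ι → ℤˣ) :
    Equiv.Perm (SatelliteIndex ι r) :=
  Equiv.prodCongr
    ((Equiv.prodShear (distinctPairPerm σ) fun p => Equiv.mulLeft (ε p.1.1 * ε p.1.2) :
      DistinctPair ι × ℤˣ ≃ DistinctPair ι × ℤˣ)) (Equiv.refl (Fin r))

namespace SpansDistinctLines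

variable {x : ι → E}

theorem abs_inner_smul_lt_one (hx : SpansDistinctLines x) (p : DistinctPair ι) (s : ℤˣ) :
    |⟪x p.1.1, realSign s • x p.1.2⟫| < 1 := by
  rw [real_inner_smul_right, abs_mul, abs_realSign, one_mul]
  exact hx.abs_inner_lt_one p.2

theorem norm_smul_eq_one (hx : SpansDistinctLines x) (s : ℤˣ) (i : ι) :
    ‖realSign s • x i‖ = 1 := by
  rw [norm_smul, Real.norm_eq_abs, abs_realSign, hx.norm_eq_one, one_mul]

theorem stereo_ne_zero (hx : SpansDistinctLines x) (p : DistinctPair ι) (s : ℤˣ) :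
    stereo (x p.1.1) (realSign s • x p.1.2) ≠ 0 := by
  obtain ⟨h1, h2⟩ := abs_lt.1 (hx.abs_inner_smul_lt_one p s)
  intro h
  have h3 := norm_stereo_sq (hx.norm_eq_one p.1.1) (hx.norm_smul_eq_one s p.1.2) (by linarith)
  rw [h, norm_zero] at h3
  have h4 := div_pos (sub_pos.2 h2) (neg_lt_iff_pos_add'.1 h1)
  linarith

end SpansDistinctLines

variable [Fintype ι] [DecidableEq ι] {r : ℕ}

/-- A lower bound for the squared sines of the angles between the vectors of a family. -/
noncomputable def separation (x : ι → E) : ℝ :=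
  ∏ p : DistinctPair ι, (1 - ⟪x p.1.1, x p.1.2⟫ ^ 2)

/-- The position of a new point in the stereographic chart around the old point to which it is
attached. -/
noncomputable def satelliteChart (x : ι → E) (k : SatelliteIndex ι r) : E :=
  (1 + k.2 * (separation x / (2 * r))) •
    stereo (x k.1.1.1.1) (realSign k.1.2 • x k.1.1.1.2)

/-- A scale small enough for new points attached to different old points to be distinct. -/
noncomputable def satelliteScale (r : ℕ) (x : ι → E) : ℝ :=
  separation x / (4 * (1 + ∑ k : SatelliteIndex ι r, ‖satelliteChart x k‖))

/-- The displacement of a new point from the old point to which it is attached. -/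
noncomputable def displacement (x : ι → E) (k : SatelliteIndex ι r) : E :=
  satelliteScale r x • satelliteChart x k

/-- The homogeneous coordinates of a new point. -/
noncomputable def satellite (x : ι → E) (k : SatelliteIndex ι r) : E :=
  x k.1.1.1.1 + displacement x k

/-! ### Equivariance under renumbering and sign changes -/

section Symmetry

variable {x y : ι → E} {σ : Equiv.Perm ι} {ε : ι → ℤˣ}

theorem separation_eq_of_symm (h : ∀ i, y i = realSign (ε i) • x (σ i)) :
    separation y = separation x := by
  unfold separation
  rw [← Equiv.prod_comp (distinctPairPerm σ) fun p => 1 - ⟪x p.1.1, x p.1.2⟫ ^ 2]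
  refine Finset.prod_congr rfl fun p _ => ?_
  change _ = 1 - ⟪x (σ p.1.1), x (σ p.1.2)⟫ ^ 2
  rw [h, h, real_inner_smul_left, real_inner_smul_right, mul_pow, mul_pow, sq,
    realSign_mul_self, sq (realSign _), realSign_mul_self, one_mul, one_mul]

theorem satelliteChart_eq_of_symm (h : ∀ i, y i = realSign (ε i) • x (σ i))
    (k : SatelliteIndex ι r) :
    satelliteChart y k =
      realSign (ε k.1.1.1.1) • satelliteChart x (satellitePerm r σ ε k) := by
  obtain ⟨⟨⟨⟨i, j⟩, hij⟩, s⟩, t⟩ := k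
  unfold satelliteChart
  rw [separation_eq_of_symm h]
  change (1 + (t : ℝ) * _) • stereo (y i) (realSign s • y j) =
    realSign (ε i) • (1 + (t : ℝ) * _) •
      stereo (x (σ i)) (realSign (ε i * ε j * s) • x (σ j))
  -- Factoring `ε i` out of both arguments of `stereo` turns the sign of `x (σ j)` into `ε i * ε j *
  -- s`, as in `satellitePerm`.
  rw [smul_comm, ← stereo_smul_smul (realSign_mul_self _), h, h, smul_smul, smul_smul,
    realSign_mul, realSign_mul, ← mul_assoc, ← mul_assoc, realSign_mul_self, one_mul,
    mul_comm (realSign s)]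

theorem satelliteScale_eq_of_symm (h : ∀ i, y i = realSign (ε i) • x (σ i)) :
    satelliteScale r y = satelliteScale r x := by
  unfold satelliteScale
  rw [separation_eq_of_symm h, ← Equiv.sum_comp (satellitePerm r σ ε) fun k => ‖satelliteChart x k‖]
  simp only [satelliteChart_eq_of_symm h, norm_smul, Real.norm_eq_abs, abs_realSign, one_mul]

theorem satellite_eq_of_symm (h : ∀ i, y i = realSign (ε i) • x (σ i))
    (k : SatelliteIndex ι r) :
    satellite y k = realSign (ε k.1.1.1.1) • satellite x (satellitePerm r σ ε k) := by
  rw [satellite, displacement, satelliteScale_eq_of_symm h, satelliteChart_eq_of_symm h, h,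
    smul_comm, ← smul_add]
  rfl

end Symmetry

/-! ### Distinctness of the new points -/

namespace SpansDistinctLines

variable {x : ι → E}

theorem separation_pos (hx : SpansDistinctLines x) : 0 < separation x :=
  Finset.prod_pos fun p _ => abs_inner_lt_one_iff.1 (hx.abs_inner_lt_one p.2)

/-- All factors of the product lie in `(0, 1]`, so it is at most each of them. -/
theorem separation_le (hx : SpansDistinctLines x) {i j : ι} (hij : i ≠ j) :
    separation x ≤ 1 - ⟪x i, x j⟫ ^ 2 := by
  have h := Finset.prod_le_prod_of_subset_of_le_one
    (f := fun p : DistinctPair ι => 1 - ⟪x p.1.1, x p.1.2⟫ ^ 2)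
    (Finset.subset_univ {(⟨(i, j), hij⟩ : DistinctPair ι)})
    (fun p _ => (abs_inner_lt_one_iff.1 (hx.abs_inner_lt_one p.2)).le)
    (fun p _ _ => sub_le_self _ (sq_nonneg _))
  rwa [Finset.prod_singleton] at h

theorem separation_le_one (hx : SpansDistinctLines x) : separation x ≤ 1 :=
  Finset.prod_le_one (fun p _ => (abs_inner_lt_one_iff.1 (hx.abs_inner_lt_one p.2)).le)
    fun _ _ => sub_le_self _ (sq_nonneg _)

theorem satelliteScale_pos (hx : SpansDistinctLines x) : 0 < satelliteScale r x := by
  have := hx.separation_pos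
  unfold satelliteScale
  positivity

theorem norm_displacement_le (hx : SpansDistinctLines x) (k : SatelliteIndex ι r) :
    ‖displacement x k‖ ≤ separation x / 4 := by
  have h1 : ‖satelliteChart x k‖ ≤ ∑ k : SatelliteIndex ι r, ‖satelliteChart x k‖ :=
    Finset.single_le_sum (f := fun k => ‖satelliteChart x k‖) (fun _ _ => norm_nonneg _)
      (Finset.mem_univ k)
  have hD := hx.separation_pos
  rw [displacement, norm_smul, Real.norm_of_nonneg hx.satelliteScale_pos.le, satelliteScale]
  set M := ∑ k : SatelliteIndex ι r, ‖satelliteChart x k‖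
  have hM : 0 < 1 + M := by linarith [norm_nonneg (satelliteChart x k)]
  rw [div_mul_eq_mul_div, div_le_div_iff₀ (by positivity) (by norm_num)]
  nlinarith

theorem inner_displacement (hx : SpansDistinctLines x) (k : SatelliteIndex ι r) :
    ⟪x k.1.1.1.1, displacement x k⟫ = 0 := by
  rw [displacement, satelliteChart, inner_smul_right, inner_smul_right,
    inner_stereo (hx.norm_eq_one _), mul_zero, mul_zero]

theorem displacement_ne_zero (hx : SpansDistinctLines x) (k : SatelliteIndex ι r) :
    displacement x k ≠ 0 := by
  have := hx.separation_pos
  exact smul_ne_zero hx.satelliteScale_pos.ne'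
    (smul_ne_zero (by positivity) (hx.stereo_ne_zero _ _))

theorem separation_le_two_mul_one_sub_inner (hx : SpansDistinctLines x) {i j : ι} {s t : ℤˣ}
    (h : (i, s) ≠ (j, t)) :
    separation x ≤ 2 * (1 - ⟪realSign s • x i, realSign t • x j⟫) := by
  rw [real_inner_smul_left, real_inner_smul_right, ← mul_assoc, ← realSign_mul]
  by_cases hij : i = j
  · subst hij
    have hst : s ≠ t := fun hst => h (by rw [hst])
    have hs : realSign (s * t) = -1 := by
      rcases Int.units_eq_one_or s with rfl | rfl <;> rcases Int.units_eq_one_or t with rfl | rfl <;>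
        simp_all [realSign]
    rw [hs, real_inner_self_eq_norm_sq, hx.norm_eq_one]
    linarith [hx.separation_le_one]
  · have h1 := hx.separation_le hij
    have h2 := realSign_mul_self (s * t)
    -- For `u = ± ⟪x i, x j⟫`, `1 - u ^ 2 ≤ 2 * (1 - u)` because `(1 - u) ^ 2 ≥ 0`.
    nlinarith [sq_nonneg (1 - realSign (s * t) * ⟪x i, x j⟫)]

/-- Equal `(j, s)` give different multiples of one nonzero vector. Otherwise the factors `1 + t * D
/ (2 r)`, with `D` the separation and `t < r`, differ by less than `D / 2`, as `smul_stereo_ne`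
requires. -/
theorem satelliteChart_ne (hx : SpansDistinctLines x) {k k' : SatelliteIndex ι r} (h : k ≠ k')
    (hi : k.1.1.1.1 = k'.1.1.1.1) : satelliteChart x k ≠ satelliteChart x k' := by
  obtain ⟨⟨⟨⟨i, j⟩, hij⟩, s⟩, t⟩ := k
  obtain ⟨⟨⟨⟨i', j'⟩, hij'⟩, s'⟩, t'⟩ := k'
  obtain rfl : i = i' := hi
  have hD := hx.separation_pos
  have hr : (0 : ℝ) < r := Nat.cast_pos.2 (Fin.pos t)
  by_cases hjs : (j, s) = (j', s')
  · obtain ⟨rfl, rfl⟩ := Prod.mk.inj hjs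
    intro heq
    have h1 := smul_left_injective ℝ (hx.stereo_ne_zero ⟨(i, j), hij⟩ s) heq
    have h2 : (t : ℝ) = t' := mul_right_cancel₀ (by positivity) (add_left_cancel h1)
    exact h (by rw [Fin.ext (Nat.cast_injective h2)])
  · refine smul_stereo_ne (hx.norm_eq_one i) (hx.norm_smul_eq_one s j) (hx.norm_smul_eq_one s' j')
      (hx.abs_inner_smul_lt_one ⟨(i, j), hij⟩ s) (hx.abs_inner_smul_lt_one ⟨(i, j'), hij'⟩ s')
      hD hx.separation_le_one (hx.separation_le_two_mul_one_sub_inner hjs)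
      (le_add_of_nonneg_right (by positivity)) ?_
    have ht : |(t' : ℝ) - t| < r := by
      have h1 : (t : ℝ) < r := Nat.cast_lt.2 t.2
      have h2 : (t' : ℝ) < r := Nat.cast_lt.2 t'.2
      exact abs_sub_lt_of_nonneg_of_lt (Nat.cast_nonneg _) h2 (Nat.cast_nonneg _) h1
    change |(1 + (t' : ℝ) * (separation x / (2 * r))) - (1 + (t : ℝ) * (separation x / (2 * r)))| < _
    rw [add_sub_add_left_eq_sub, ← sub_mul, abs_mul,
      abs_of_pos (a := separation x / (2 * r)) (by positivity)]
    calc |(t' : ℝ) - t| * (separation x / (2 * r)) < r * (separation x / (2 * r)) := by gcongr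
      _ = separation x / 2 := by field_simp

theorem satellite_ne_zero (hx : SpansDistinctLines x) (k : SatelliteIndex ι r) :
    satellite x k ≠ 0 := by
  intro h
  have h1 := congrArg (fun v => ⟪x k.1.1.1.1, v⟫) h
  simp only [satellite, inner_add_right, hx.inner_displacement, real_inner_self_eq_norm_sq,
    hx.norm_eq_one, inner_zero_right] at h1
  norm_num at h1

theorem satellite_ne_smul_satellite (hx : SpansDistinctLines x) {k k' : SatelliteIndex ι r}
    (h : k ≠ k') {c : ℝ} (hc : c ≠ 0) : satellite x k ≠ c • satellite x k' := by
  by_cases hi : k.1.1.1.1 = k'.1.1.1.1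
  · intro heq
    have hk' := hx.inner_displacement k'
    unfold satellite at heq
    rw [← hi] at heq hk'
    exact hx.satelliteChart_ne h hi (smul_right_injective E hx.satelliteScale_pos.ne'
      (eq_of_add_eq_smul_add (hx.norm_eq_one _) (hx.inner_displacement k) hk' heq))
  · exact add_ne_smul_add (hx.norm_eq_one _) (hx.norm_eq_one _) hx.separation_pos
      hx.separation_le_one (hx.separation_le hi) (hx.norm_displacement_le k)
      (hx.norm_displacement_le k') hc

theorem ne_smul_satellite (hx : SpansDistinctLines x) (i : ι) (k : SatelliteIndex ι r)
    {c : ℝ} (hc : c ≠ 0) : x i ≠ c • satellite x k := by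
  rw [← add_zero (x i)]
  by_cases hi : i = k.1.1.1.1
  · subst hi
    exact fun heq => hx.displacement_ne_zero k (eq_of_add_eq_smul_add (hx.norm_eq_one _)
      (inner_zero_right _) (hx.inner_displacement k) heq).symm
  · exact add_ne_smul_add (hx.norm_eq_one _) (hx.norm_eq_one _) hx.separation_pos
      hx.separation_le_one (hx.separation_le hi)
      (by rw [norm_zero]; linarith [hx.separation_pos]) (hx.norm_displacement_le k) hc

end SpansDistinctLines

theorem continuous_satellite {Y : Type*} [TopologicalSpace Y] {x : Y → ι → E} (hc : Continuous x)
    (hx : ∀ y, SpansDistinctLines (x y)) (k : SatelliteIndex ι r) :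
    Continuous fun y => satellite (x y) k := by
  have hxi : ∀ i, Continuous fun y => x y i := fun i => (continuous_apply i).comp hc
  have hsep : Continuous fun y => separation (x y) := by
    unfold separation
    fun_prop
  have hchart : ∀ k : SatelliteIndex ι r, Continuous fun y => satelliteChart (x y) k := by
    intro k
    have h : ∀ y, 1 + ⟪x y k.1.1.1.1, realSign k.1.2 • x y k.1.1.1.2⟫ ≠ 0 := fun y =>
      (neg_lt_iff_pos_add'.1 (abs_lt.1 ((hx y).abs_inner_smul_lt_one k.1.1 k.1.2)).1).ne'
    unfold satelliteChart stereo
    fun_prop (disch := assumption)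
  have hscale : Continuous fun y => satelliteScale r (x y) := by
    unfold satelliteScale
    refine hsep.div (by fun_prop) fun y => ?_
    positivity
  exact (hxi _).add (hscale.smul (hchart k))

theorem card_satelliteIndex :
    Fintype.card (SatelliteIndex ι r) = Fintype.card ι * (Fintype.card ι - 1) * 2 * r := by
  have h : Fintype.card (DistinctPair ι) = Fintype.card ι * (Fintype.card ι - 1) := by
    rw [Fintype.card_subtype, Nat.mul_sub_one, ← Finset.card_univ, ← Finset.offDiag_card]
    congr 1
    ext p
    simp
  simp only [Fintype.card_prod, h, Fintype.card_fin, Fintype.card_units_int]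

end Satellites

/-! ### Mixed configurations and homogeneous coordinates -/

theorem orbitRel_blockSubgroup_of_perm {n m : ℕ} {X : Type*} {p p' : OrdConf (n + m) X}
    (σ : Equiv.Perm (Fin n)) (τ : Equiv.Perm (Fin m))
    (hσ : ∀ i, p'.1 (Fin.castAdd m i) = p.1 (Fin.castAdd m (σ i)))
    (hτ : ∀ j, p'.1 (Fin.natAdd n j) = p.1 (Fin.natAdd n (τ j))) :
    (MulAction.orbitRel (blockSubgroup n m) (OrdConf (n + m) X)).r p' p := by
  set f := (finSumFinEquiv (m := n) (n := m)).permCongrHom.toMonoidHom.comp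
    (Equiv.Perm.sumCongrHom (Fin n) (Fin m)) with hf
  -- A permutation acts by precomposition with its inverse, whence the inverse here.
  refine ⟨⟨f (σ, τ)⁻¹, ⟨_, rfl⟩⟩, Subtype.ext (funext fun q => ?_)⟩
  change p.1 ((f (σ, τ)⁻¹)⁻¹ q) = p'.1 q
  rw [map_inv, inv_inv]
  refine Fin.addCases (fun i => ?_) (fun j => ?_) q
  · rw [hσ]
    simp [hf, Equiv.permCongrHom, Equiv.permCongr_apply]
  · rw [hτ]
    simp [hf, Equiv.permCongrHom, Equiv.permCongr_apply]

/-- Openness matters because, unlike mere quotient maps, open ones are stable under products and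
under restriction to preimages. -/
theorem isOpenQuotientMap_mk_antipodal :
    IsOpenQuotientMap (Quotient.mk antipodal) where
  surjective := Quotient.mk_surjective
  continuous := continuous_quotient_mk'
  isOpenMap U hU := by
    have h : Quotient.mk antipodal ⁻¹' (Quotient.mk antipodal '' U) = U ∪ Neg.neg ⁻¹' U := by
      ext x
      constructor
      · rintro ⟨y, hy, hyx⟩
        rcases Quotient.exact hyx with rfl | rfl
        · exact Or.inl hy
        · exact Or.inr hy
      · rintro (hx | hx)
        · exact ⟨x, hx, rfl⟩
        · exact ⟨-x, hx, Quotient.sound (Or.inr rfl)⟩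
    rw [← isQuotientMap_quotient_mk'.isOpen_preimage]
    exact h ▸ hU.union (hU.preimage continuous_neg)

/-- The point of the projective plane with given homogeneous coordinates. -/
noncomputable def ofCoordinates (y : {y : EuclideanSpace ℝ (Fin 3) // y ≠ 0}) : RP2 :=
  Quotient.mk antipodal ⟨‖y.1‖⁻¹ • y.1, by
    rw [mem_sphere_zero_iff_norm, norm_smul, norm_inv, norm_norm,
      inv_mul_cancel₀ (norm_ne_zero_iff.2 y.2)]⟩

theorem continuous_ofCoordinates : Continuous ofCoordinates := by
  refine continuous_quotient_mk'.comp (Continuous.subtype_mk ?_ _)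
  exact (continuous_subtype_val.norm.inv₀ fun y => norm_ne_zero_iff.2 y.2).smul
    continuous_subtype_val

theorem ofCoordinates_coe (x : Sphere2) (hx : x.1 ≠ 0) :
    ofCoordinates ⟨x.1, hx⟩ = Quotient.mk antipodal x := by
  refine congrArg (Quotient.mk antipodal) (Subtype.ext ?_)
  change ‖x.1‖⁻¹ • x.1 = x.1
  rw [norm_eq_of_mem_sphere, inv_one, one_smul]

theorem exists_eq_smul_of_ofCoordinates_eq {y z : {y : EuclideanSpace ℝ (Fin 3) // y ≠ 0}}
    (h : ofCoordinates y = ofCoordinates z) : ∃ c : ℝ, c ≠ 0 ∧ y.1 = c • z.1 := by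
  have hy := norm_ne_zero_iff.2 y.2
  have hz := norm_ne_zero_iff.2 z.2
  rcases Quotient.exact h with h | h
  · have h1 : ‖y.1‖⁻¹ • y.1 = ‖z.1‖⁻¹ • z.1 := congrArg Subtype.val h
    refine ⟨‖y.1‖ * ‖z.1‖⁻¹, mul_ne_zero hy (inv_ne_zero hz), ?_⟩
    rw [mul_smul, ← h1, smul_inv_smul₀ hy]
  · have h1 : ‖y.1‖⁻¹ • y.1 = -(‖z.1‖⁻¹ • z.1) := congrArg Subtype.val h
    refine ⟨-(‖y.1‖ * ‖z.1‖⁻¹), neg_ne_zero.2 (mul_ne_zero hy (inv_ne_zero hz)), ?_⟩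
    rw [neg_smul, mul_smul, ← smul_neg, ← h1, smul_inv_smul₀ hy]

theorem ofCoordinates_eq_of_eq_realSign_smul {y z : {y : EuclideanSpace ℝ (Fin 3) // y ≠ 0}}
    (s : ℤˣ) (h : y.1 = realSign s • z.1) : ofCoordinates y = ofCoordinates z := by
  have hn : ‖y.1‖ = ‖z.1‖ := by rw [h, norm_smul, Real.norm_eq_abs, abs_realSign, one_mul]
  refine Quotient.sound ?_
  rcases Int.units_eq_one_or s with rfl | rfl
  · left
    apply Subtype.ext
    change ‖y.1‖⁻¹ • y.1 = ‖z.1‖⁻¹ • z.1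
    rw [hn, h]
    simp [realSign]
  · right
    apply Subtype.ext
    change ‖y.1‖⁻¹ • y.1 = -(‖z.1‖⁻¹ • z.1)
    rw [hn, h]
    simp [realSign]

/-! ### Lifting configurations to the sphere -/

/-- Lifts to the sphere of the ordered configurations of points of the projective plane. -/
abbrev LiftedConf (n : ℕ) : Type :=
  Pi.map (fun _ : Fin n => Quotient.mk antipodal) ⁻¹' {p : Fin n → RP2 | Function.Injective p}

/-- The underlying vectors of a lifted configuration. -/
def LiftedConf.vectors {n : ℕ} (x : LiftedConf n) (i : Fin n) : EuclideanSpace ℝ (Fin 3) := x.1 i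

/-- The configuration of lines spanned by a lifted configuration. -/
def LiftedConf.proj {n : ℕ} : LiftedConf n → OrdConf n RP2 :=
  Set.restrictPreimage {p : Fin n → RP2 | Function.Injective p}
    (Pi.map fun _ => Quotient.mk antipodal)

theorem LiftedConf.isQuotientMap_proj {n : ℕ} : Topology.IsQuotientMap (proj (n := n)) :=
  ((IsOpenQuotientMap.piMap fun _ => isOpenQuotientMap_mk_antipodal).restrictPreimage
    _).isQuotientMap

theorem LiftedConf.continuous_vectors {n : ℕ} : Continuous (vectors (n := n)) :=
  continuous_pi fun i =>
    continuous_subtype_val.comp ((continuous_apply i).comp continuous_subtype_val)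

theorem LiftedConf.spansDistinctLines {n : ℕ} (x : LiftedConf n) :
    SpansDistinctLines x.vectors where
  norm_eq_one i := norm_eq_of_mem_sphere (x.1 i)
  abs_inner_lt_one i j hij := by
    have hi : ‖x.vectors i‖ = 1 := norm_eq_of_mem_sphere (x.1 i)
    have hj : ‖x.vectors j‖ = 1 := norm_eq_of_mem_sphere (x.1 j)
    have hne : ¬ antipodal.r (x.1 i) (x.1 j) := fun h => hij (x.2 (Quotient.sound h))
    have hle : |⟪x.vectors i, x.vectors j⟫| ≤ 1 := by
      simpa [hi, hj] using abs_real_inner_le_norm (x.vectors i) (x.vectors j)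
    -- Equality in Cauchy-Schwarz would make the two lifts equal or antipodal.
    refine abs_lt.2 ⟨?_, ?_⟩
    · refine lt_of_le_of_ne (abs_le.1 hle).1 fun h => hne (Or.inr ?_)
      exact Subtype.ext ((inner_eq_neg_one_iff_of_norm_eq_one hi hj).1 h.symm)
    · refine lt_of_le_of_ne (abs_le.1 hle).2 fun h => hne (Or.inl ?_)
      exact Subtype.ext ((inner_eq_one_iff_of_norm_eq_one hi hj).1 h)

theorem LiftedConf.exists_symm {n : ℕ} {x y : LiftedConf n}
    (h : (Quotient.mk _ y.proj : UConf n RP2) = Quotient.mk _ x.proj) :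
    ∃ (σ : Equiv.Perm (Fin n)) (ε : Fin n → ℤˣ),
      ∀ i, y.vectors i = realSign (ε i) • x.vectors (σ i) := by
  obtain ⟨σ, hσ⟩ := Quotient.exact h
  have hi : ∀ i, ∃ s : ℤˣ, y.vectors i = realSign s • x.vectors (σ⁻¹ i) := by
    intro i
    have h1 : Quotient.mk antipodal (y.1 i) = Quotient.mk antipodal (x.1 (σ⁻¹ i)) :=
      (congrFun (congrArg Subtype.val hσ) i).symm
    rcases Quotient.exact h1 with h2 | h2
    · exact ⟨1, by simp [realSign, vectors, h2]⟩
    · exact ⟨-1, by simp [realSign, vectors, h2]⟩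
  choose ε hε using hi
  exact ⟨σ⁻¹, ε, hε⟩

/-! ### The cross-section -/

section Section

variable {n m r : ℕ} (e : Fin m ≃ SatelliteIndex (Fin n) r)

/-- The points of the projective plane added to a configuration. -/
noncomputable def satellitePoint (x : LiftedConf n) (k : SatelliteIndex (Fin n) r) : RP2 :=
  ofCoordinates ⟨satellite x.vectors k, x.spansDistinctLines.satellite_ne_zero k⟩

theorem continuous_satellitePoint (k : SatelliteIndex (Fin n) r) :
    Continuous fun x : LiftedConf n => satellitePoint x k :=
  continuous_ofCoordinates.comp (Continuous.subtype_mk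
    (continuous_satellite LiftedConf.continuous_vectors
      (fun x => x.spansDistinctLines) k) _)

theorem satellitePoint_injective (x : LiftedConf n) :
    Function.Injective (satellitePoint (r := r) x) := by
  intro k k' h
  by_contra hk
  obtain ⟨c, hc, h1⟩ := exists_eq_smul_of_ofCoordinates_eq h
  exact x.spansDistinctLines.satellite_ne_smul_satellite hk hc h1

theorem proj_ne_satellitePoint (x : LiftedConf n) (i : Fin n) (k : SatelliteIndex (Fin n) r) :
    x.proj.1 i ≠ satellitePoint x k := by
  intro h
  have hi : (x.1 i).1 ≠ 0 := ne_zero_of_mem_unit_sphere _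
  have h1 : ofCoordinates ⟨(x.1 i).1, hi⟩ = satellitePoint x k := (ofCoordinates_coe _ hi).trans h
  obtain ⟨c, hc, h2⟩ := exists_eq_smul_of_ofCoordinates_eq h1
  exact x.spansDistinctLines.ne_smul_satellite i k hc h2

/-- The ordered configuration obtained by adding points to a configuration. -/
noncomputable def addSatellites (x : LiftedConf n) : OrdConf (n + m) RP2 :=
  ⟨Sum.elim x.proj.1 (satellitePoint x ∘ e) ∘ finSumFinEquiv.symm,
    (x.proj.2.sumElim ((satellitePoint_injective x).comp e.injective)
      fun _ _ => proj_ne_satellitePoint x _ _).comp finSumFinEquiv.symm.injective⟩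

theorem addSatellites_castAdd (x : LiftedConf n) (i : Fin n) :
    (addSatellites e x).1 (Fin.castAdd m i) = x.proj.1 i := by
  simp [addSatellites]

theorem addSatellites_natAdd (x : LiftedConf n) (j : Fin m) :
    (addSatellites e x).1 (Fin.natAdd n j) = satellitePoint x (e j) := by
  simp [addSatellites]

theorem continuous_addSatellites : Continuous (addSatellites e) := by
  refine Continuous.subtype_mk (continuous_pi fun q => ?_) _
  refine Fin.addCases (fun i => ?_) (fun j => ?_) q
  · have h : Continuous fun x : LiftedConf n => x.proj.1 i := (continuous_apply i).comp
      (continuous_subtype_val.comp LiftedConf.isQuotientMap_proj.continuous)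
    simpa using h
  · simpa using continuous_satellitePoint (e j)

theorem forgetOrd_addSatellites (x : LiftedConf n) :
    forgetOrd n m RP2 (addSatellites e x) = x.proj :=
  Subtype.ext (funext fun i => addSatellites_castAdd e x i)

theorem addSatellites_rel {x y : LiftedConf n}
    (h : (Quotient.mk _ y.proj : UConf n RP2) = Quotient.mk _ x.proj) :
    (Quotient.mk _ (addSatellites e y) : MConf n m RP2) = Quotient.mk _ (addSatellites e x) := by
  obtain ⟨σ, ε, hε⟩ := LiftedConf.exists_symm h
  refine Quotient.sound (orbitRel_blockSubgroup_of_perm σ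
    ((e.trans (satellitePerm r σ ε)).trans e.symm) (fun i => ?_) fun j => ?_)
  · rw [addSatellites_castAdd, addSatellites_castAdd]
    have hy : (y.1 i).1 ≠ 0 := ne_zero_of_mem_unit_sphere _
    have hx : (x.1 (σ i)).1 ≠ 0 := ne_zero_of_mem_unit_sphere _
    exact (ofCoordinates_coe _ hy).symm.trans
      ((ofCoordinates_eq_of_eq_realSign_smul (ε i) (hε i)).trans (ofCoordinates_coe _ hx))
  · rw [addSatellites_natAdd, addSatellites_natAdd]
    simp only [Equiv.trans_apply, Equiv.apply_symm_apply]
    exact ofCoordinates_eq_of_eq_realSign_smul _ (satellite_eq_of_symm hε (e j))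

end Section

/-- The map on lifts is continuous and constant on the fibres of a quotient map, so it descends; the
section identity is checked on lifts. -/
theorem hasCrossSection_forget_of_equiv {n m r : ℕ} (e : Fin m ≃ SatelliteIndex (Fin n) r) :
    HasCrossSection (forget n m RP2) := by
  have hq : Topology.IsQuotientMap
      fun x : LiftedConf n => (Quotient.mk _ x.proj : UConf n RP2) :=
    isQuotientMap_quotient_mk'.comp LiftedConf.isQuotientMap_proj
  let S : C(LiftedConf n, MConf n m RP2) :=
    ⟨fun x => Quotient.mk _ (addSatellites e x),
      continuous_quotient_mk'.comp (continuous_addSatellites e)⟩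
  let Q : C(LiftedConf n, UConf n RP2) := ⟨_, hq.continuous⟩
  have hQ : Topology.IsQuotientMap Q := hq
  have hS : Function.FactorsThrough S Q := fun _ _ h => addSatellites_rel e h
  refine ⟨hQ.lift S hS, ContinuousMap.ext fun z => ?_⟩
  obtain ⟨x, rfl⟩ := hQ.surjective z
  have h := DFunLike.congr_fun (hQ.lift_comp S hS) x
  change forget n m RP2 (hQ.lift S hS (Q x)) = Q x
  rw [show hQ.lift S hS (Q x) = S x from h]
  exact congrArg (Quotient.mk _) (forgetOrd_addSatellites e x)

/-- One can continuously add `2 r n (n - 1)` points to the configurations of `n` points of the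
projective plane. -/
theorem hasCrossSection_forget {n m : ℕ} (r : ℕ) (hm : m = n * (n - 1) * 2 * r) :
    HasCrossSection (forget n m RP2) :=
  hasCrossSection_forget_of_equiv (r := r)
    (Fintype.equivOfCardEq (by rw [card_satelliteIndex, Fintype.card_fin, Fintype.card_fin, hm]))

end MixedConf

theorem theoremD (n : ℕ) (hn : 3 ≤ n) :
    (∀ k : ℕ, 1 ≤ k →
      MixedConf.HasCrossSection
        (MixedConf.forget n (k * n * (2 * n - 1) * (2 * n - 2)) MixedConf.RP2)) ∧
    MixedConf.HasCrossSection (MixedConf.forget n (2 * n * (n - 1)) MixedConf.RP2) := by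
  -- Since `2n - 2 = 2 (n - 1)`, the first family is `n (n - 1) * 2 * r` with `r = k (2n - 1)`.
  refine ⟨fun k _ => MixedConf.hasCrossSection_forget (k * (2 * n - 1)) ?_,
    MixedConf.hasCrossSection_forget 1 (by ring)⟩
  rw [show 2 * n - 2 = 2 * (n - 1) by omega]
  ring
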